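/- For an integer $m\ge 3$ let $P_m(x)=\frac{(m-2)x^2-(m-4)x}{2}$. For a vector $\mathbf a=(a_1,\dots,a_k)$ of positive integers, the $m$-gonal form with coefficient vector $\mathbf a$ is $p_m(\mathbf a)(x_1,\dots,x_k)=a_1P_m(x_1)+\cdots+a_kP_m(x_k)$. Let $V'_m(\mathbf a)$ be the set of nonzero integers of the form $p_m(\mathbf a)(x_1,\dots,x_k)$ with $x_1,\dots,x_k\in\mathbb Z$. For a positive integer $n$ let $\mathcal T(n)$ be the set of all integers greater than or equal to $n$. The form $p_m(\mathbf a)$ is called tight $\mathcal T(n)$-universal if $V'_m(\mathbf a)=\mathcal T(n)$, and new tight $\mathcal T(n)$-universal if moreover $V'_m(\mathbf b)\subsetneq\mathcal T(n)$ for every proper subsequence $\mathbf b$ of $\mathbf a$ (the empty one included, with $V'_m(\mathbf b)=\varnothing$). Put $\mathbf x_n=(n,n,n+1,n+2,\dots,2n-1)$ and $\mathbf y_n=(n,n+1,n+2,\dots,2n)$. Theorem. Let $m\ge 8$ and $n\ge 2m-5$ be integers. Then, up to reordering of the coefficients, there are exactly two new tight $\mathcal T(n)$-universal $m$-gonal forms,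 namely $p_m(\mathbf x_n)$ and $p_m(\mathbf y_n)$. That is, for a finite vector $\mathbf a$ of positive integers, $p_m(\mathbf a)$ is new tight $\mathcal T(n)$-universal if and only if $\mathbf a$ is a permutation of $\mathbf x_n$ or of $\mathbf y_n$, and $\mathbf x_n$, $\mathbf y_n$ are not permutations of each other. -/

import Mathlib

/-- The polynomial `P_m(x) = ((m - 2) x² - (m - 4) x) / 2`; the numerator is always even, so the
integer division is exact. Its values at the integers are the generalized `m`-gonal numbers. -/
def polygonalNumber (m : ℕ) (x : ℤ) : ℤ :=
  (((m : ℤ) - 2) * x ^ 2 - ((m : ℤ) - 4) * x) / 2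

/-- The `m`-gonal form `p_m(a)(x₁, …, x_k) = a₁ P_m(x₁) + ⋯ + a_k P_m(x_k)` with coefficient
vector `a = (a₁, …, a_k)`. -/
def polygonalForm (m : ℕ) (a : List ℕ) (x : Fin a.length → ℤ) : ℤ :=
  ∑ i, (a.get i : ℤ) * polygonalNumber m (x i)

/-- The set of nonzero integers represented by the `m`-gonal form `p_m(a)`. -/
def representedSet (m : ℕ) (a : List ℕ) : Set ℤ :=
  {N | N ≠ 0 ∧ ∃ x : Fin a.length → ℤ, polygonalForm m a x = N}

/-- `T(n)`: the set of integers greater than or equal to `n`. -/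
def tailSet (n : ℕ) : Set ℤ :=
  {N | (n : ℤ) ≤ N}

/-- `p_m(a)`, with `a` a vector of positive integers, is tight `T(n)`-universal. -/
def IsTightUniversal (m n : ℕ) (a : List ℕ) : Prop :=
  (∀ c ∈ a, 0 < c) ∧ representedSet m a = tailSet n

/-- `p_m(a)` is new tight `T(n)`-universal: it is tight `T(n)`-universal, and every proper
subsequence `b` of `a` represents only a proper subset of `T(n)`. -/
def IsNewTightUniversal (m n : ℕ) (a : List ℕ) : Prop :=
  IsTightUniversal m n a ∧
    ∀ b : List ℕ, b.Sublist a → b ≠ a → representedSet m b ⊂ tailSet n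

/-- `x_n = (n, n, n + 1, n + 2, …, 2n - 1)`. -/
def xVec (n : ℕ) : List ℕ := n :: List.range' n n

/-- `y_n = (n, n + 1, n + 2, …, 2n)`. -/
def yVec (n : ℕ) : List ℕ := List.range' n (n + 1)


/-!
Every `m`-gonal number other than `0` and `1` is at least `m - 3`. Hence, when all coefficients are
at least `n`, a number below `3 n` can only be represented as a sum of coefficients. Representing
`n, …, 2n - 1` forces each of these numbers to be a coefficient, and representing `2n` forces either
`2n` or a second `n`: this gives `y_n` or `x_n`.

Conversely, put `x, y, z, w, -2s, w, z, y, x` with `s = x + y + z + w` in front of the nine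
consecutive coefficients `n, …, n + 8`. The linear parts of the polygonal numbers cancel and
`(m - 2) (n + 4) (x² + y² + z² + w² + 2s²)` remains. By Lagrange's theorem the quaternary form takes
every value `k ≢ 1 (mod 3)`, so that it is enough to reach the `3 (m - 2) (n + 4)` numbers of one
window from these multiples with the remaining coefficients. For `n ≥ 41` their subset sums suffice;
for `n ≤ 40` there are finitely many pairs `(m, n)`, and the window is computed.
-/

/-! ### Generalized polygonal numbers -/

theorem two_mul_polygonalNumber (m : ℕ) (x : ℤ) :
    2 * polygonalNumber m x = ((m : ℤ) - 2) * x ^ 2 - ((m : ℤ) - 4) * x := by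
  apply Int.mul_ediv_cancel'
  obtain ⟨t, ht⟩ := Int.even_mul_succ_self x
  exact ⟨((m : ℤ) - 2) * (t - x) + x, by linear_combination ((m : ℤ) - 2) * ht⟩

theorem polygonalNumber_zero (m : ℕ) : polygonalNumber m 0 = 0 := by
  linarith [two_mul_polygonalNumber m 0]

theorem polygonalNumber_one (m : ℕ) : polygonalNumber m 1 = 1 := by
  linarith [two_mul_polygonalNumber m 1]

theorem sub_three_le_polygonalNumber {m : ℕ} (hm : 3 ≤ m) {x : ℤ} (h₀ : x ≠ 0) (h₁ : x ≠ 1) :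
    (m : ℤ) - 3 ≤ polygonalNumber m x := by
  have hm' : (3 : ℤ) ≤ m := by exact_mod_cast hm
  have hfactor : 2 * (polygonalNumber m x - ((m : ℤ) - 3)) =
      (x + 1) * (((m : ℤ) - 2) * x - 2 * ((m : ℤ) - 3)) := by
    linear_combination two_mul_polygonalNumber m x
  have hnonneg : 0 ≤ (x + 1) * (((m : ℤ) - 2) * x - 2 * ((m : ℤ) - 3)) := by
    rcases (show x ≤ -1 ∨ 2 ≤ x by omega) with hx | hx
    · exact mul_nonneg_of_nonpos_of_nonpos (by omega) (by nlinarith [hm'])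
    · exact mul_nonneg (by omega) (by nlinarith [hm'])
  linarith

theorem polygonalNumber_nonneg {m : ℕ} (hm : 3 ≤ m) (x : ℤ) : 0 ≤ polygonalNumber m x := by
  rcases eq_or_ne x 0 with rfl | h₀
  · rw [polygonalNumber_zero]
  rcases eq_or_ne x 1 with rfl | h₁
  · rw [polygonalNumber_one]
    exact zero_le_one
  · linarith [sub_three_le_polygonalNumber hm h₀ h₁, (show (3 : ℤ) ≤ m by exact_mod_cast hm)]

/-! ### Representations -/

/-- The `m`-gonal form with coefficient list `a` takes the value `N`, which may be zero. The
variables are quantified one coefficient at a time, to allow for induction on `a`. -/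
def Represents (m : ℕ) : List ℕ → ℤ → Prop
  | [], N => N = 0
  | c :: a, N => ∃ x : ℤ, Represents m a (N - c * polygonalNumber m x)

theorem exists_polygonalForm_eq_iff (m : ℕ) (a : List ℕ) (N : ℤ) :
    (∃ x : Fin a.length → ℤ, polygonalForm m a x = N) ↔ Represents m a N := by
  induction a generalizing N with
  | nil => simp [polygonalForm, Represents, eq_comm]
  | cons c a ih =>
    have hcons (x : Fin (a.length + 1) → ℤ) : polygonalForm m (c :: a) x =
        c * polygonalNumber m (x 0) + polygonalForm m a (Fin.tail x) :=
      Fin.sum_univ_succ _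
    simp only [Represents, ← ih, eq_sub_iff_add_eq']
    constructor
    · rintro ⟨x, hx⟩
      exact ⟨x 0, Fin.tail x, by rw [← hcons, hx]⟩
    · rintro ⟨t, x, hx⟩
      exact ⟨Fin.cons (α := fun _ => ℤ) t x, by rw [hcons, Fin.cons_zero, Fin.tail_cons, hx]⟩

theorem mem_representedSet {m : ℕ} {a : List ℕ} {N : ℤ} :
    N ∈ representedSet m a ↔ N ≠ 0 ∧ Represents m a N := by
  simp only [representedSet, Set.mem_ofPred_eq, exists_polygonalForm_eq_iff]

namespace Represents

variable {m n : ℕ} {a b : List ℕ} {M N : ℤ}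

theorem perm (hN : Represents m a N) (h : a.Perm b) : Represents m b N := by
  induction h generalizing N with
  | nil => exact hN
  | cons c _ ih => exact hN.imp fun _ => ih
  | swap c d l =>
    obtain ⟨x, y, hxy⟩ := hN
    exact ⟨y, x, by rwa [sub_right_comm]⟩
  | trans _ _ ih₁ ih₂ => exact ih₂ (ih₁ hN)

theorem sublist (hN : Represents m a N) (h : a.Sublist b) : Represents m b N := by
  induction h generalizing N with
  | slnil => exact hN
  | cons c _ ih => exact ⟨0, ih (by simpa [polygonalNumber_zero] using hN)⟩
  | cons_cons c _ ih => exact hN.imp fun _ => ih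

theorem subperm (hN : Represents m a N) : a.Subperm b → Represents m b N :=
  fun ⟨_, hperm, hsub⟩ => (hN.perm hperm.symm).sublist hsub

theorem append (hM : Represents m a M) (hN : Represents m b N) :
    Represents m (a ++ b) (M + N) := by
  induction a generalizing M with
  | nil =>
    obtain rfl : M = 0 := hM
    simpa using hN
  | cons c a ih =>
    obtain ⟨x, hx⟩ := hM
    exact ⟨x, sub_add_eq_add_sub M _ N ▸ ih hx⟩

theorem list_sum (m : ℕ) (a : List ℕ) : Represents m a a.sum := by
  induction a with
  | nil => simp [Represents]
  | cons c a ih => exact ⟨1, by simpa [polygonalNumber_one] using ih⟩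

theorem of_mem {c : ℕ} (h : c ∈ a) : Represents m a c := by
  simpa using (list_sum m [c]).sublist (List.singleton_sublist.2 h)

theorem eq_zero_or_le (hm : 3 ≤ m) (ha : ∀ c ∈ a, n ≤ c) (hN : Represents m a N) :
    N = 0 ∨ (n : ℤ) ≤ N := by
  induction a generalizing N with
  | nil => exact Or.inl hN
  | cons c a ih =>
    rw [List.forall_mem_cons] at ha
    obtain ⟨x, hx⟩ := hN
    have hrest := ih ha.2 hx
    rcases (polygonalNumber_nonneg hm x).eq_or_lt with hP | hP
    · simpa [← hP] using hrest
    · have hcP : (n : ℤ) ≤ c * polygonalNumber m x := by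
        nlinarith [(show (n : ℤ) ≤ c by exact_mod_cast ha.1)]
      right
      rcases hrest with h | h <;> linarith [Int.natCast_nonneg n]

theorem nonneg (hm : 3 ≤ m) (hN : Represents m a N) : 0 ≤ N :=
  (hN.eq_zero_or_le hm fun c _ => Nat.zero_le c).elim ge_of_eq id

theorem exists_sublist_sum_eq (hm : 3 ≤ m) (ha : ∀ c ∈ a, n ≤ c) (hN : Represents m a N)
    (hlt : N < ((m : ℤ) - 3) * n) : ∃ b : List ℕ, b.Sublist a ∧ (b.sum : ℤ) = N := by
  induction a generalizing N with
  | nil => exact ⟨[], List.Sublist.refl _, by simpa using Eq.symm hN⟩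
  | cons c a ih =>
    rw [List.forall_mem_cons] at ha
    obtain ⟨x, hx⟩ := hN
    rcases eq_or_ne x 0 with rfl | h₀
    · rw [polygonalNumber_zero, mul_zero, sub_zero] at hx
      obtain ⟨b, hb, hsum⟩ := ih ha.2 hx hlt
      exact ⟨b, hb.cons c, hsum⟩
    rcases eq_or_ne x 1 with rfl | h₁
    · rw [polygonalNumber_one, mul_one] at hx
      obtain ⟨b, hb, hsum⟩ := ih ha.2 hx (by linarith [Int.natCast_nonneg c])
      exact ⟨c :: b, hb.cons_cons c, by rw [List.sum_cons, Nat.cast_add, hsum]; ring⟩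
    · have hcP : ((m : ℤ) - 3) * n ≤ polygonalNumber m x * c :=
        mul_le_mul (sub_three_le_polygonalNumber hm h₀ h₁) (by exact_mod_cast ha.1)
          (Int.natCast_nonneg n) (polygonalNumber_nonneg hm x)
      linarith [hx.nonneg hm]

/-! ### Forced coefficients -/

theorem mem_of_lt_two_mul (hm : 5 ≤ m) (ha : ∀ c ∈ a, n ≤ c) {c : ℕ} (hc : Represents m a c)
    (hpos : 0 < c) (hlt : c < 2 * n) : c ∈ a := by
  have hm' : (5 : ℤ) ≤ m := by exact_mod_cast hm
  obtain ⟨b, hba, hsum⟩ := hc.exists_sublist_sum_eq (by omega) ha (by nlinarith [hm'])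
  rw [Nat.cast_inj] at hsum
  have hlen : b.length * n ≤ b.sum := List.card_nsmul_le_sum b n fun d hd => ha d (hba.subset hd)
  match b with
  | [] => simp at hsum; omega
  | [d] =>
    obtain rfl : d = c := by simpa using hsum
    exact List.singleton_sublist.1 hba
  | d :: e :: l => simp only [List.length_cons, hsum] at hlen; nlinarith

theorem mem_or_sublist_of_two_mul (hm : 6 ≤ m) (hn : 0 < n) (ha : ∀ c ∈ a, n ≤ c)
    (h : Represents m a (2 * n : ℕ)) : 2 * n ∈ a ∨ [n, n].Sublist a := by
  have hm' : (6 : ℤ) ≤ m := by exact_mod_cast hm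
  obtain ⟨b, hba, hsum⟩ := h.exists_sublist_sum_eq (by omega) ha (by push_cast; nlinarith [hm'])
  rw [Nat.cast_inj] at hsum
  have hge : ∀ d ∈ b, n ≤ d := fun d hd => ha d (hba.subset hd)
  have hlen : b.length * n ≤ b.sum := List.card_nsmul_le_sum b n hge
  match b with
  | [] => simp at hsum; omega
  | [d] =>
    obtain rfl : d = 2 * n := by simpa using hsum
    exact Or.inl (List.singleton_sublist.1 hba)
  | [d, e] =>
    have hd := hge d (by simp)
    have he := hge e (by simp)
    have hde : d + e = 2 * n := by simpa using hsum
    obtain ⟨rfl, rfl⟩ : d = n ∧ e = n := by omega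
    exact Or.inr hba
  | d :: e :: f :: l => simp only [List.length_cons, hsum] at hlen; nlinarith

end Represents

theorem representedSet_subset_tailSet {m n : ℕ} {a : List ℕ} (hm : 3 ≤ m) (ha : ∀ c ∈ a, n ≤ c) :
    representedSet m a ⊆ tailSet n := fun _ hN =>
  have ⟨hne, hrep⟩ := mem_representedSet.1 hN
  (hrep.eq_zero_or_le hm ha).resolve_left hne

theorem xVec_subperm {n : ℕ} {a : List ℕ} (hdup : [n, n].Sublist a)
    (hmem : ∀ c, n ≤ c → c < 2 * n → c ∈ a) : (xVec n).Subperm a := by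
  rw [List.subperm_ext_iff]
  intro d hd
  have hcount : (List.range' n n).count d ≤ 1 :=
    List.nodup_iff_count_le_one.1 List.nodup_range' d
  rcases eq_or_ne d n with rfl | hdn
  · calc (xVec d).count d = (List.range' d d).count d + 1 := List.count_cons_self
      _ ≤ 2 := by omega
      _ = [d, d].count d := by simp
      _ ≤ a.count d := hdup.count_le d
  · rw [xVec, List.count_cons_of_ne hdn.symm]
    refine hcount.trans (List.count_pos_iff.2 ?_)
    simp only [xVec, List.mem_cons, List.mem_range'_1] at hd
    exact hmem d (by omega) (by omega)

theorem yVec_subperm {n : ℕ} {a : List ℕ} (htwo : 2 * n ∈ a)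
    (hmem : ∀ c, n ≤ c → c < 2 * n → c ∈ a) : (yVec n).Subperm a := by
  refine List.subperm_of_subset List.nodup_range' fun d hd => ?_
  rw [yVec, List.mem_range'_1] at hd
  rcases eq_or_ne d (2 * n) with rfl | hne
  · exact htwo
  · exact hmem d hd.1 (by omega)

namespace IsTightUniversal

variable {m n : ℕ} {a : List ℕ}

theorem represents (h : IsTightUniversal m n a) {N : ℤ} (hN : (n : ℤ) ≤ N) : Represents m a N :=
  (mem_representedSet.1 (h.2.symm ▸ hN : N ∈ representedSet m a)).2

theorem le_of_mem (h : IsTightUniversal m n a) {c : ℕ} (hc : c ∈ a) : n ≤ c := by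
  have hmem : (c : ℤ) ∈ representedSet m a :=
    mem_representedSet.2 ⟨by exact_mod_cast (h.1 c hc).ne', Represents.of_mem hc⟩
  rw [h.2] at hmem
  exact Int.ofNat_le.1 hmem

theorem xVec_or_yVec_subperm (hm : 6 ≤ m) (hn : 0 < n) (h : IsTightUniversal m n a) :
    (xVec n).Subperm a ∨ (yVec n).Subperm a := by
  have hge : ∀ c ∈ a, n ≤ c := fun c hc => h.le_of_mem hc
  have hmem : ∀ c, n ≤ c → c < 2 * n → c ∈ a := fun c hc hlt =>
    (h.represents (by exact_mod_cast hc)).mem_of_lt_two_mul (by omega) hge (by omega) hlt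
  rcases (h.represents (by omega)).mem_or_sublist_of_two_mul hm hn hge with htwo | hdup
  · exact Or.inr (yVec_subperm htwo hmem)
  · exact Or.inl (xVec_subperm hdup hmem)

end IsTightUniversal

/-! ### Nine consecutive coefficients -/

theorem exists_sq_eq_and_modEq_sq (a : ℤ) : ∃ b : ℤ, b ^ 2 = a ^ 2 ∧ b ≡ a ^ 2 [ZMOD 3] := by
  rcases (show a % 3 = 0 ∨ a % 3 = 1 ∨ a % 3 = 2 by omega) with h | h | h
  · exact ⟨a, rfl, by simp [Int.ModEq, pow_two, Int.mul_emod, h]⟩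
  · exact ⟨a, rfl, by simp [Int.ModEq, pow_two, Int.mul_emod, h]⟩
  · exact ⟨-a, neg_sq a, by
      have hneg : -a % 3 = 1 := by omega
      simp [Int.ModEq, pow_two, Int.mul_emod, h, hneg]⟩

theorem exists_sq_eq_and_three_dvd_sum {ι : Type*} [Fintype ι] (a : ι → ℤ)
    (ha : (∑ i, a i ^ 2) % 3 ≠ 1) : ∃ b : ι → ℤ, (∀ i, b i ^ 2 = a i ^ 2) ∧ 3 ∣ ∑ i, b i := by
  classical
  choose b hsq hmod using fun i => exists_sq_eq_and_modEq_sq (a i)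
  have hsum : ∑ i, b i ≡ ∑ i, a i ^ 2 [ZMOD 3] := Int.ModEq.sum fun i _ => hmod i
  by_cases hdvd : 3 ∣ ∑ i, b i
  · exact ⟨b, hsq, hdvd⟩
  -- Now the sum is `2` modulo `3`, and reversing one `b j ≡ 1` changes it by `-2`.
  obtain ⟨j, hj⟩ : ∃ j, ¬ 3 ∣ b j := by
    by_contra! hall
    exact hdvd (Finset.dvd_sum fun i _ => hall i)
  have hbj : b j % 3 = 1 := by
    have hmod_j : b j ≡ b j ^ 2 [ZMOD 3] := hsq j ▸ hmod j
    rcases (show b j % 3 = 1 ∨ b j % 3 = 2 by omega) with h | h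
    · exact h
    · simp [Int.ModEq, pow_two, Int.mul_emod, h] at hmod_j
  refine ⟨Function.update b j (-b j), fun i => ?_, ?_⟩
  · rcases eq_or_ne i j with rfl | hij
    · rw [Function.update_self, neg_sq, hsq]
    · rw [Function.update_of_ne hij, hsq]
  · have hupdate := Finset.sum_update_of_mem (Finset.mem_univ j) b (-b j)
    have hsplit := Finset.add_sum_erase Finset.univ b (Finset.mem_univ j)
    rw [Finset.sdiff_singleton_eq_erase] at hupdate
    rw [Int.ModEq] at hsum
    omega

theorem exists_sum_sq_add_two_mul_sum_sq {k : ℕ} (hk : k % 3 ≠ 1) :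
    ∃ x y z w : ℤ, x ^ 2 + y ^ 2 + z ^ 2 + w ^ 2 + 2 * (x + y + z + w) ^ 2 = k := by
  obtain ⟨a, b, c, d, hsq⟩ := Nat.sum_four_squares k
  have hsq' : (a : ℤ) ^ 2 + (b : ℤ) ^ 2 + (c : ℤ) ^ 2 + (d : ℤ) ^ 2 = k := by exact_mod_cast hsq
  obtain ⟨u, hu, t, ht⟩ := exists_sq_eq_and_three_dvd_sum ![(a : ℤ), b, c, d]
    (by simp [Fin.sum_univ_four, hsq']; omega)
  rw [Fin.sum_univ_four] at ht
  have hu₀ : u 0 ^ 2 = a ^ 2 := hu 0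
  have hu₁ : u 1 ^ 2 = b ^ 2 := hu 1
  have hu₂ : u 2 ^ 2 = c ^ 2 := hu 2
  have hu₃ : u 3 ^ 2 = d ^ 2 := hu 3
  refine ⟨u 0 - t, u 1 - t, u 2 - t, u 3 - t, ?_⟩
  linear_combination hsq' + hu₀ + hu₁ + hu₂ + hu₃ +
    (2 * (u 0 + u 1 + u 2 + u 3) - 12 * t) * ht

theorem represents_nine_consecutive (m c : ℕ) {k : ℕ} (hk : k % 3 ≠ 1) :
    Represents m (List.range' c 9) (((m : ℤ) - 2) * (c + 4) * k) := by
  obtain ⟨x, y, z, w, hk⟩ := exists_sum_sq_add_two_mul_sum_sq hk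
  simp only [List.range', Represents]
  refine ⟨x, y, z, w, -2 * (x + y + z + w), w, z, y, x, ?_⟩
  apply mul_left_cancel₀ (two_ne_zero (α := ℤ))
  rw [← hk]
  push_cast
  linear_combination (-2 * (c + 4 : ℤ)) * (two_mul_polygonalNumber m x +
    two_mul_polygonalNumber m y + two_mul_polygonalNumber m z + two_mul_polygonalNumber m w) -
    (c + 4 : ℤ) * two_mul_polygonalNumber m (-2 * (x + y + z + w))

theorem Represents.append_of_window {m G n₀ N : ℕ} {a b : List ℕ} (hG : 0 < G)
    (ha : ∀ k : ℕ, k % 3 ≠ 1 → Represents m a (G * k : ℕ))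
    (hwindow : ∀ r : ℕ, n₀ ≤ r → r < n₀ + 3 * G →
      ∃ k : ℕ, k % 3 ≠ 1 ∧ Represents m b ((r : ℤ) - (G * k : ℕ)))
    (hN : n₀ ≤ N) : Represents m (a ++ b) N := by
  have hmod := Nat.mod_lt (N - n₀) (show 0 < 3 * G by omega)
  have hdiv := Nat.div_add_mod (N - n₀) (3 * G)
  set q := (N - n₀) / (3 * G)
  set r := (N - n₀) % (3 * G)
  obtain ⟨k, hk, hb⟩ := hwindow (n₀ + r) (by omega) (by omega)
  have hNr : (N : ℤ) = n₀ + (3 * G * q + r) := by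
    exact_mod_cast (show N = n₀ + (3 * G * q + r) by omega)
  convert (ha (k + 3 * q) (by omega)).append hb using 1
  rw [hNr]
  push_cast
  ring

theorem represents_of_window {m n e n₀ N : ℕ} (hm : 3 ≤ m) (hn : 9 ≤ n)
    (hwindow : ∀ r : ℕ, n₀ ≤ r → r < n₀ + 3 * ((m - 2) * (n + 4)) → ∃ k : ℕ, k % 3 ≠ 1 ∧
      Represents m (e :: List.range' (n + 9) (n - 9)) ((r : ℤ) - ((m - 2) * (n + 4) * k : ℕ)))
    (hN : n₀ ≤ N) : Represents m (e :: List.range' n n) N := by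
  have hnine (k : ℕ) (hk : k % 3 ≠ 1) :
      Represents m (List.range' n 9) ((m - 2) * (n + 4) * k : ℕ) := by
    have hcast : (((m - 2) * (n + 4) * k : ℕ) : ℤ) = ((m : ℤ) - 2) * (n + 4) * k := by
      push_cast [Nat.cast_sub (show 2 ≤ m by omega)]
      ring
    exact hcast ▸ represents_nine_consecutive m n hk
  have hsplit : List.range' n n = List.range' n 9 ++ List.range' (n + 9) (n - 9) := by
    rw [List.range'_append_1, Nat.add_sub_cancel' hn]
  rw [hsplit]
  exact (Represents.append_of_window (Nat.mul_pos (by omega) (by omega)) hnine hwindow hN).perm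
    List.perm_middle

/-! ### Subset sums of consecutive integers -/

theorem succ_choose_two (j : ℕ) : (j + 1).choose 2 = j + j.choose 2 := by
  rw [Nat.choose_succ_succ' j 1, Nat.choose_one_right]

/-- These are the sums of `j` among the `j + d` numbers `c, …, c + j + d - 1`. -/
theorem exists_sublist_range'_sum_eq (c j d : ℕ) {t : ℕ} (ht : t ≤ j * d) :
    ∃ l : List ℕ, l.Sublist (List.range' c (j + d)) ∧ l.sum = j * c + j.choose 2 + t := by
  induction j generalizing d t with
  | zero => exact ⟨[], List.nil_sublist _, by simp at ht ⊢; omega⟩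
  | succ j ih =>
    have with_top {d t : ℕ} (hdt : d ≤ t) (ht : t ≤ (j + 1) * d) :
        ∃ l : List ℕ, l.Sublist (List.range' c (j + 1 + d)) ∧
          l.sum = (j + 1) * c + (j + 1).choose 2 + t := by
      obtain ⟨l, hl, hsum⟩ := ih d (t := t - d) (by rw [Nat.add_one_mul] at ht; omega)
      refine ⟨l ++ [c + (j + d)], ?_, ?_⟩
      · rw [Nat.add_right_comm, List.range'_1_concat]
        exact hl.append (List.Sublist.refl _)
      · rw [List.sum_append, List.sum_singleton, hsum, succ_choose_two, Nat.add_one_mul]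
        omega
    induction d with
    | zero => exact with_top (Nat.zero_le t) ht
    | succ d ihd =>
      by_cases h : t ≤ (j + 1) * d
      · obtain ⟨l, hl, hsum⟩ := ihd h
        exact ⟨l, hl.trans (List.range'_sublist_right.2 (by omega)), hsum⟩
      · exact with_top (by nlinarith) ht

/-- The bound on `c` makes the intervals of sums of `j` and of `j + 1` numbers adjacent, for every
`j` with `p ≤ j < q`. -/
theorem exists_sublist_range'_sum_eq_of_le {c p q s : ℕ} (hpq : p ≤ q) (hc : c + p ≤ p * q + 1)
    (hps : p * c + p.choose 2 ≤ s) (hsq : s ≤ q * c + q.choose 2 + q * p) :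
    ∃ l : List ℕ, l.Sublist (List.range' c (p + q)) ∧ l.sum = s := by
  suffices h : ∀ j, p ≤ j → ∀ d, p ≤ d → j + d = p + q → s ≤ j * c + j.choose 2 + j * d →
      ∃ l : List ℕ, l.Sublist (List.range' c (p + q)) ∧ l.sum = s from
    h q hpq p le_rfl (Nat.add_comm q p) hsq
  have of_mem_interval {j d : ℕ} (hjd : j + d = p + q) (hlow : j * c + j.choose 2 ≤ s)
      (hupp : s ≤ j * c + j.choose 2 + j * d) :
      ∃ l : List ℕ, l.Sublist (List.range' c (p + q)) ∧ l.sum = s := by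
    obtain ⟨t, rfl⟩ := Nat.exists_eq_add_of_le hlow
    exact hjd ▸ exists_sublist_range'_sum_eq c j d (by omega)
  intro j hj
  induction j, hj using Nat.le_induction with
  | base => exact fun d _ hd => of_mem_interval hd hps
  | succ j hj ih =>
    intro d hpd hjd hupp
    by_cases h : s ≤ j * c + j.choose 2 + j * (d + 1)
    · exact ih (d + 1) (by omega) (by omega) h
    · refine of_mem_interval hjd ?_ hupp
      have hcjd : c ≤ j * d + 1 := by
        obtain ⟨u, rfl⟩ := Nat.exists_eq_add_of_le hj
        obtain ⟨v, rfl⟩ := Nat.exists_eq_add_of_le hpd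
        obtain rfl : q = p + u + v + 1 := by omega
        nlinarith [Nat.zero_le (u * v)]
      rw [succ_choose_two]
      nlinarith

theorem represents_cons_range'_of_le (m e : ℕ) {c q s : ℕ} (hq : 2 ≤ q) (hc : c + 1 ≤ 2 * q)
    (hlow : 2 * c + 1 ≤ s) (hupp : 2 * s ≤ 2 * q * c + q * (q + 3)) :
    Represents m (e :: List.range' c (2 + q)) s := by
  have hchoose : 2 * q.choose 2 + q = q * q := by
    rw [Nat.choose_two_right, Nat.mul_div_cancel' (Nat.even_mul_pred_self q).two_dvd,
      ← Nat.mul_add_one, Nat.sub_add_cancel (by omega)]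
  obtain ⟨l, hl, rfl⟩ := exists_sublist_range'_sum_eq_of_le hq (by omega) (by simpa using hlow)
    (show s ≤ q * c + q.choose 2 + q * 2 by nlinarith)
  exact (Represents.list_sum m l).sublist (hl.cons e)

theorem represents_of_lt {m n e N : ℕ} (hn : 13 ≤ n) (he : e = n ∨ e = 2 * n) (hN : n ≤ N)
    (hlt : N < 2 * n + 19) : Represents m (e :: List.range' n n) N := by
  rcases lt_trichotomy N (2 * n) with h | rfl | h
  · exact Represents.of_mem (List.mem_cons_of_mem e (List.mem_range'_1.2 (by omega)))
  · rcases he with rfl | rfl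
    · have hdup : [e, e].Sublist (e :: List.range' e e) :=
        (List.singleton_sublist.2 (List.mem_range'_1.2 (by omega))).cons_cons e
      simpa [two_mul] using (Represents.list_sum m [e, e]).sublist hdup
    · exact Represents.of_mem List.mem_cons_self
  · obtain ⟨q, rfl⟩ := Nat.exists_eq_add_of_le (show 2 ≤ n by omega)
    exact represents_cons_range'_of_le m e (by omega) (by omega) (by omega) (by nlinarith)

theorem represents_of_large {m n e N : ℕ} (hm : 3 ≤ m) (hmn : 2 * m ≤ n + 5) (hn : 41 ≤ n)
    (he : e = n ∨ e = 2 * n) (hN : n ≤ N) : Represents m (e :: List.range' n n) N := by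
  rcases lt_or_ge N (2 * n + 19) with hlt | hge
  · exact represents_of_lt (by omega) he hN hlt
  refine represents_of_window hm (by omega) (fun r hr₁ hr₂ => ?_) hge
  set G := (m - 2) * (n + 4) with hG
  have two_mul_G_le : 2 * G ≤ (n + 1) * (n + 4) := by
    rw [hG, ← mul_assoc]
    exact Nat.mul_le_mul_right _ (by omega)
  have hsums {s : ℕ} (hs₁ : 2 * n + 19 ≤ s) (hs₂ : s < 2 * n + 19 + 2 * G) :
      Represents m (e :: List.range' (n + 9) (n - 9)) s := by
    obtain ⟨q, rfl⟩ := Nat.exists_eq_add_of_le' (show 11 ≤ n by omega)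
    rw [show q + 11 - 9 = 2 + q by omega]
    exact represents_cons_range'_of_le m e (by omega) (by omega) (by omega) (by nlinarith)
  rcases lt_or_ge r (2 * n + 19 + 2 * G) with hr | hr
  · exact ⟨0, by norm_num, by simpa using hsums hr₁ hr⟩
  · refine ⟨2, by norm_num, ?_⟩
    rw [← Nat.cast_sub (by omega)]
    exact hsums (by omega) (by omega)

/-! ### Sumsets as bit masks -/

/-- The union of the translates by the numbers in `shifts` of a finite set of natural numbers.
A set is encoded as the natural number whose binary digit `i` is `1` exactly when `i` belongs to
it, so that the kernel computes with it by its fast arithmetic. -/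
def translateMask (mask : ℕ) (shifts : List ℕ) : ℕ :=
  shifts.foldr (fun s acc => mask <<< s ||| acc) 0

theorem testBit_translateMask {mask i : ℕ} {shifts : List ℕ} :
    (translateMask mask shifts).testBit i = true ↔
      ∃ s ∈ shifts, s ≤ i ∧ mask.testBit (i - s) = true := by
  induction shifts with
  | nil => simp [translateMask]
  | cons s shifts ih =>
    simp only [translateMask, List.foldr_cons, Nat.testBit_or, Nat.testBit_shiftLeft,
      Bool.or_eq_true, Bool.and_eq_true, decide_eq_true_eq, List.exists_mem_cons_iff] at ih ⊢
    rw [ih]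

/-- The set encoded by `mask` contains all numbers `i` with `s ≤ i < t`. -/
def MaskContainsIco (mask s t : ℕ) : Prop :=
  (mask >>> s) % 2 ^ (t - s) = 2 ^ (t - s) - 1

instance (mask s t : ℕ) : Decidable (MaskContainsIco mask s t) :=
  inferInstanceAs (Decidable (_ = _))

theorem MaskContainsIco.testBit {mask s t i : ℕ} (h : MaskContainsIco mask s t) (hs : s ≤ i)
    (ht : i < t) : mask.testBit i = true := by
  have hbit := congrArg (fun k => k.testBit (i - s)) h
  simpa [Nat.testBit_mod_two_pow, Nat.testBit_two_pow_sub_one, Nat.testBit_shiftRight,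
    Nat.add_sub_cancel' hs, Nat.sub_lt_sub_right hs ht] using hbit

/-- The values `P_m(x)` for `-R ≤ x ≤ R`. -/
def polygonalValues (m R : ℕ) : List ℕ :=
  (List.range (2 * R + 1)).map fun i => (polygonalNumber m ((i : ℤ) - R)).toNat

/-- The mask of the numbers below `B` represented by the `m`-gonal form with the given coefficients
and with variables between `-R` and `R`. -/
def valueMask (m R B : ℕ) : List ℕ → ℕ
  | [] => 1
  | c :: a => translateMask (valueMask m R B a) ((polygonalValues m R).map (c * ·)) % 2 ^ B

theorem represents_of_testBit_valueMask {m R B i : ℕ} {a : List ℕ} (hm : 3 ≤ m)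
    (h : (valueMask m R B a).testBit i = true) : Represents m a i := by
  induction a generalizing i with
  | nil =>
    rw [valueMask, Nat.testBit_one_eq_true_iff_self_eq_zero] at h
    exact Nat.cast_eq_zero.2 h
  | cons c a ih =>
    rw [valueMask, Nat.testBit_mod_two_pow, Bool.and_eq_true] at h
    obtain ⟨s, hs, hle, hbit⟩ := testBit_translateMask.1 h.2
    simp only [polygonalValues, List.map_map, List.mem_map, Function.comp_apply] at hs
    obtain ⟨j, -, rfl⟩ := hs
    refine ⟨(j : ℤ) - R, ?_⟩
    simpa [Nat.cast_sub hle, Int.toNat_of_nonneg (polygonalNumber_nonneg hm _)] using ih hbit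

/-- A finite computation showing that `e, n, n + 1, …, 2n - 1` represent every number from `n` on:
`[n, n₀)` is covered directly, and the window of length `3 (m - 2) (n + 4)` from `n₀` on is covered
with the nine coefficients `n, …, n + 8` restricted to the values of `represents_nine_consecutive`.
Variables are taken between `-R` and `R`. -/
def CoverCheck (R n₀ m n e : ℕ) : Prop :=
  MaskContainsIco (valueMask m R n₀ (e :: List.range' n n)) n n₀ ∧
  MaskContainsIco
    (translateMask
      (valueMask m R (n₀ + 3 * ((m - 2) * (n + 4))) (e :: List.range' (n + 9) (n - 9)))
      (((List.range (n₀ / ((m - 2) * (n + 4)) + 3)).filter (· % 3 ≠ 1)).map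
        ((m - 2) * (n + 4) * ·)))
    n₀ (n₀ + 3 * ((m - 2) * (n + 4)))

instance (R n₀ m n e : ℕ) : Decidable (CoverCheck R n₀ m n e) :=
  inferInstanceAs (Decidable (_ ∧ _))

theorem CoverCheck.represents {R n₀ m n e N : ℕ} (h : CoverCheck R n₀ m n e) (hm : 3 ≤ m)
    (hn : 9 ≤ n) (hN : n ≤ N) : Represents m (e :: List.range' n n) N := by
  rcases lt_or_ge N n₀ with hlt | hge
  · exact represents_of_testBit_valueMask hm (h.1.testBit hN hlt)
  · refine represents_of_window hm hn (fun r hr₁ hr₂ => ?_) hge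
    obtain ⟨s, hs, hle, hbit⟩ := testBit_translateMask.1 (h.2.testBit hr₁ hr₂)
    obtain ⟨k, hk, rfl⟩ := List.mem_map.1 hs
    refine ⟨k, by simpa using (List.mem_filter.1 hk).2, ?_⟩
    rw [← Nat.cast_sub hle]
    exact represents_of_testBit_valueMask hm hbit

theorem coverCheck_eleven : ∀ m ∈ Finset.Icc 6 8, ∀ e ∈ [11, 22], CoverCheck 14 16000 m 11 e := by
  decide +kernel

theorem coverCheck_of_le_forty : ∀ n ∈ Finset.Icc 12 40, ∀ m ∈ Finset.Icc 6 22,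
    2 * m ≤ n + 5 → ∀ e ∈ [n, 2 * n], CoverCheck 3 1000 m n e := by
  decide +kernel

theorem represents_of_le {m n e : ℕ} {N : ℤ} (hm : 6 ≤ m) (hn : 11 ≤ n) (hmn : 2 * m ≤ n + 5)
    (he : e = n ∨ e = 2 * n) (hN : (n : ℤ) ≤ N) : Represents m (e :: List.range' n n) N := by
  lift N to ℕ using by omega
  have hN' : n ≤ N := Int.ofNat_le.1 hN
  rcases lt_or_ge 40 n with hlarge | hsmall
  · exact represents_of_large (by omega) hmn hlarge he hN'
  have he' : e ∈ [n, 2 * n] := by simpa using he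
  rcases hn.eq_or_lt with rfl | hlt
  · exact (coverCheck_eleven m (Finset.mem_Icc.2 (by omega)) e he').represents
      (by omega) (by omega) hN'
  · exact (coverCheck_of_le_forty n (Finset.mem_Icc.2 ⟨hlt, hsmall⟩) m
      (Finset.mem_Icc.2 (by omega)) hmn e he').represents (by omega) (by omega) hN'

/-! ### Classification -/

section

variable {m n : ℕ} {a : List ℕ}

theorem yVec_perm (n : ℕ) : (2 * n :: List.range' n n).Perm (yVec n) := by
  rw [yVec, List.range'_1_concat, ← two_mul]
  exact (List.perm_append_singleton _ _).symm

theorem isTightUniversal_iff (hm : 6 ≤ m) (hn : 11 ≤ n) (hmn : 2 * m ≤ n + 5) :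
    IsTightUniversal m n a ↔ (∀ c ∈ a, n ≤ c) ∧ ((xVec n).Subperm a ∨ (yVec n).Subperm a) := by
  constructor
  · exact fun h => ⟨fun c => h.le_of_mem, h.xVec_or_yVec_subperm hm (by omega)⟩
  rintro ⟨hge, hsub⟩
  refine ⟨fun c hc => lt_of_lt_of_le (by omega) (hge c hc),
    (representedSet_subset_tailSet (by omega) hge).antisymm fun N hN => ?_⟩
  have hN' : (n : ℤ) ≤ N := hN
  refine mem_representedSet.2 ⟨by omega, ?_⟩
  rcases hsub with hsub | hsub
  · exact (represents_of_le hm hn hmn (Or.inl rfl) hN').subperm hsub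
  · exact ((represents_of_le hm hn hmn (Or.inr rfl) hN').perm (yVec_perm n)).subperm hsub

theorem isNewTightUniversal_iff (hm : 6 ≤ m) (hn : 11 ≤ n) (hmn : 2 * m ≤ n + 5) :
    IsNewTightUniversal m n a ↔ a.Perm (xVec n) ∨ a.Perm (yVec n) := by
  constructor
  · rintro ⟨htight, hnew⟩
    obtain ⟨hge, hsub⟩ := (isTightUniversal_iff hm hn hmn).1 htight
    have eq_of_sublist {b : List ℕ} (hba : b.Sublist a)
        (hb : (xVec n).Subperm b ∨ (yVec n).Subperm b) : b = a := by
      by_contra hne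
      exact (hnew b hba hne).ne
        ((isTightUniversal_iff hm hn hmn).2 ⟨fun c hc => hge c (hba.subset hc), hb⟩).2
    rcases hsub with ⟨b, hperm, hba⟩ | ⟨b, hperm, hba⟩
    · exact Or.inl (eq_of_sublist hba (Or.inl hperm.symm.subperm) ▸ hperm)
    · exact Or.inr (eq_of_sublist hba (Or.inr hperm.symm.subperm) ▸ hperm)
  · intro ha
    have hge : ∀ c ∈ a, n ≤ c := fun c hc => by
      rcases ha.imp (·.subset hc) (·.subset hc) with h | h <;>
        simp only [xVec, yVec, List.mem_cons, List.mem_range'_1] at h <;> omega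
    have hlen : a.length = n + 1 := by
      rcases ha with ha | ha <;> simp [ha.length_eq, xVec, yVec]
    have htight : IsTightUniversal m n a := (isTightUniversal_iff hm hn hmn).2
      ⟨hge, ha.imp (·.symm.subperm) (·.symm.subperm)⟩
    refine ⟨htight, fun b hba hne => ?_⟩
    refine (representedSet_subset_tailSet (by omega) fun c hc =>
      hge c (hba.subset hc)).ssubset_of_ne fun heq => hne (hba.eq_of_length_le ?_)
    have hb : IsTightUniversal m n b := ⟨fun c hc => htight.1 c (hba.subset hc), heq⟩
    rcases hb.xVec_or_yVec_subperm hm (by omega) with h | h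
    · simpa [hlen, xVec] using h.length_le
    · simpa [hlen, yVec] using h.length_le

theorem not_xVec_perm_yVec (hn : 0 < n) : ¬ (xVec n).Perm (yVec n) := by
  intro h
  have hmem : 2 * n ∈ xVec n := h.symm.subset (by simp [yVec, List.mem_range'_1]; omega)
  simp only [xVec, List.mem_cons, List.mem_range'_1] at hmem
  omega

end

theorem mainTheorem8_general (m n : ℕ) (hm : 6 ≤ m) (hn : 11 ≤ n) (hmn : 2 * m ≤ n + 5) :
    (∀ a : List ℕ, IsNewTightUniversal m n a ↔ a.Perm (xVec n) ∨ a.Perm (yVec n)) ∧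
    {s : Multiset ℕ |
      ∃ a : List ℕ, IsNewTightUniversal m n a ∧ (a : Multiset ℕ) = s}.ncard = 2 := by
  refine ⟨fun a => isNewTightUniversal_iff hm hn hmn, ?_⟩
  have hset : {s : Multiset ℕ | ∃ a : List ℕ, IsNewTightUniversal m n a ∧ (a : Multiset ℕ) = s} =
      {(xVec n : Multiset ℕ), (yVec n : Multiset ℕ)} := by
    ext s
    simp only [Set.mem_ofPred_eq, isNewTightUniversal_iff hm hn hmn, Set.mem_insert_iff,
      Set.mem_singleton_iff]
    constructor
    · rintro ⟨a, ha, rfl⟩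
      exact ha.imp Multiset.coe_eq_coe.2 Multiset.coe_eq_coe.2
    · rintro (rfl | rfl)
      · exact ⟨_, Or.inl (List.Perm.refl _), rfl⟩
      · exact ⟨_, Or.inr (List.Perm.refl _), rfl⟩
  rw [hset, Set.ncard_pair]
  exact fun h => not_xVec_perm_yVec (by omega) (Multiset.coe_eq_coe.1 h)

theorem mainTheorem8 (m n : ℕ) (hm : 8 ≤ m) (hn : 2 * m ≤ n + 5) :
    (∀ a : List ℕ, IsNewTightUniversal m n a ↔ a.Perm (xVec n) ∨ a.Perm (yVec n)) ∧
    {s : Multiset ℕ | ∃ a : List ℕ, IsNewTightUniversal m n a ∧ (a : Multiset ℕ) = s}.ncard = 2 :=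
  mainTheorem8_general m n (by omega) (by omega) hn
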